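/- Let $\ell,m,n$ be positive integers, and let $A(\ell,m)$ be the $(\ell+m)\times(\ell+m)$ matrix with block form $$A(\ell,m)=\left[\begin{array}{c|c}1&1\\\hline 1&0\end{array}\right],$$ where the upper left block is the $\ell\times\ell$ all-ones matrix, the two off-diagonal blocks consist entirely of ones, and the lower right block is the $m\times m$ zero matrix. For a zero-one matrix $A=(a_{ij})$ with rows and columns indexed by a set of colors, let $t_A(n)$ be the number of plane trees (rooted ordered trees) with $n$ vertices whose vertices are colored in such a way that a vertex of color $j$ is a child of a vertex of color $i$ only if $a_{ij}=1$; let $t_A^{(i)}(n)$ be the number of those trees whose root has color $i$. For $n\ge 2$, $$t_{A(\ell,m)}(n)=\sum_{k=0}^{n-1}\frac{2}{n}\binom{n}{k}\binom{2n-3}{n-k-1}\ell^{n-k}m^k.$$ For $1\le i\le \ell$ (and all $n\ge 1$), $$t^{(i)}_{A(\ell,m)}(n)=\sum_{k=0}^{n-1}\frac1n\binom{n}{k}\binom{2n-2}{n-k-1}\ell^{n-k-1}m^k.$$ For $\ell+1\le i\le \ell+m$ and $n\ge 2$, $$t^{(i)}_{A(\ell,m)}(n)=\sum_{k=1}^{n-1}\frac1{n-1}\binom{n-1}{k-1}\binom{2n-2}{n-k-1}\ell^{n-k}m^{k-1}.$$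 -/

import Mathlib

/-- A plane tree (rooted ordered tree) each of whose vertices carries a color from `κ`: a root with
its color, together with the list, from left to right, of the subtrees at the children of the root.
An empty list of subtrees means that the root is a leaf. -/
inductive ColoredPlaneTree (κ : Type) : Type
  | node (color : κ) (subtrees : List (ColoredPlaneTree κ)) : ColoredPlaneTree κ

namespace ColoredPlaneTree

/-- The color of the root. -/
def rootColor {κ : Type} : ColoredPlaneTree κ → κ
  | node c _ => c

/-- The number of vertices. -/
def numVertices {κ : Type} : ColoredPlaneTree κ → ℕ
  | node _ ts => 1 + (ts.map numVertices).sum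

/-- The coloring of the tree obeys the rule given by the matrix `A`: a vertex of color `j` is a
child of a vertex of color `i` only if `A i j = 1`. -/
inductive Obeys {κ : Type} (A : Matrix κ κ ℕ) : ColoredPlaneTree κ → Prop
  | node (c : κ) (ts : List (ColoredPlaneTree κ))
      (hroot : ∀ t ∈ ts, A c t.rootColor = 1) (hsub : ∀ t ∈ ts, Obeys A t) :
      Obeys A (node c ts)

end ColoredPlaneTree

/-- `t_A(n)`: the number of plane trees with `n` vertices colored according to the rule `A`. -/
noncomputable def treeCount {κ : Type} (A : Matrix κ κ ℕ) (n : ℕ) : ℕ :=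
  {T : ColoredPlaneTree κ | T.numVertices = n ∧ T.Obeys A}.ncard

/-- `t_A^{(i)}(n)`: the number of those trees whose root has color `i`. -/
noncomputable def treeCountRoot {κ : Type} (A : Matrix κ κ ℕ) (i : κ) (n : ℕ) : ℕ :=
  {T : ColoredPlaneTree κ | T.numVertices = n ∧ T.Obeys A ∧ T.rootColor = i}.ncard

/-- The `(ℓ + m) × (ℓ + m)` coloring matrix with block form `[[1, 1], [1, 0]]`, where the upper left
block is the all-ones `ℓ × ℓ` matrix and the lower right block is the zero `m × m` matrix. -/
def blockColoringMatrix (ℓ m : ℕ) : Matrix (Fin (ℓ + m)) (Fin (ℓ + m)) ℕ :=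
  Matrix.reindex finSumFinEquiv finSumFinEquiv
    (Matrix.fromBlocks
      (Matrix.of fun (_ : Fin ℓ) (_ : Fin ℓ) => 1) (Matrix.of fun (_ : Fin ℓ) (_ : Fin m) => 1)
      (Matrix.of fun (_ : Fin m) (_ : Fin ℓ) => 1) (0 : Matrix (Fin m) (Fin m) ℕ))

/-!
A tree whose root has color `c` is a forest allowed below `c` with a root added, and a nonempty
forest splits into the forest below its first root and its remaining trees. Hence the generating
functions `G_c` of the forests below color `c` (`ColoredPlaneTree.forestSeries`) satisfy
`G_c = 1 / (1 - X ∑ G_d)`, summed over the colors `d` allowed below `c`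
(`ColoredPlaneTree.forestSeries_mul`).

For the block matrix, all `G_c` with `c` among the first `ℓ` colors equal one series `P`, and the
others equal one series `Q`, with `P = 1 / (1 - X (ℓ P + m Q))` and `Q = 1 / (1 - ℓ X P)`. Putting
`u = ℓ X P`, the second equation reads `Q = 1 / (1 - u)`, and the first becomes `u = X φ(u)` with
`φ(u) = (ℓ (1 - u) + m u) / (1 - u) ^ 2` (`lagrange_equation_of_block_system`). Lagrange inversion
(`PowerSeries.lagrange_inversion`, proved by induction on the coefficient index) then gives the
coefficients of `u` and of `1 / (1 - u)`, that is, of `P` and `Q`, as coefficients of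
`(ℓ (1 - X) + m X) ^ p / (1 - X) ^ q`, which the binomial theorem expands. The count of all trees is
`ℓ` times the first plus `m` times the second, and the two sums merge term by term
(`choose_identity`).
-/

/-! ### Lagrange inversion -/

open PowerSeries in
theorem PowerSeries.coeff_subst_eq_sum_range {K : Type*} [Field K] {f : K⟦X⟧}
    (hf : X ∣ f) (H : K⟦X⟧) (n : ℕ) :
    coeff n (H.subst f) = ∑ k ∈ Finset.range (n + 1), coeff k H * coeff n (f ^ k) := by
  have hs : HasSubst f := HasSubst.of_constantCoeff_zero' (X_dvd_iff.mp hf)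
  rw [coeff_subst' hs, finsum_eq_sum_of_support_subset (s := Finset.range (n + 1))]
  · simp only [smul_eq_mul]
  · intro k hk
    by_contra h
    apply hk
    have : n < k := by simpa using h
    simp [X_pow_dvd_iff.mp (pow_dvd_pow_of_dvd hf k) n this]

open PowerSeries in
/-- Lagrange inversion for arbitrary `H` follows from its validity for the powers `X ^ k`, because
only `k ≤ n + 1` contribute to the coefficient of `X ^ (n + 1)`. The power case at a fixed exponent
is a hypothesis so that the induction proving the power case can use this lemma. -/
theorem PowerSeries.coeff_subst_of_coeff_pow {K : Type*} [Field K] {f φ : K⟦X⟧}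
    (hf : X ∣ f) (n : ℕ)
    (hpow : ∀ k ≤ n + 1, ((n + 1 : ℕ) : K) * coeff (n + 1) (f ^ k) =
      k * coeff (n + 1 - k) (φ ^ (n + 1))) (H : K⟦X⟧) :
    ((n : K) + 1) * coeff (n + 1) (H.subst f) = coeff n (d⁄dX K H * φ ^ (n + 1)) := by
  rw [coeff_subst_eq_sum_range hf, coeff_mul, Finset.Nat.sum_antidiagonal_eq_sum_range_succ_mk,
    Finset.mul_sum, Finset.sum_range_succ']
  have h0 := hpow 0 (by omega)
  push_cast at h0
  rw [mul_left_comm, h0]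
  simp only [zero_mul, mul_zero, add_zero, Nat.succ_eq_add_one]
  refine Finset.sum_congr rfl fun k hk => ?_
  have hk' : k < n + 1 := by simpa using hk
  have h := hpow (k + 1) (by omega)
  rw [Nat.add_sub_add_right] at h
  push_cast at h
  rw [mul_left_comm, h, coeff_derivative]
  ring

open PowerSeries in
/-- **Lagrange inversion for powers.** By strong induction on `n`: since `f ^ k` equals
`X ^ k * (φ ^ k)(f)`, its coefficient at `n` is that of `(φ ^ k)(f)` at `n - k < n`, to which the
induction hypothesis applies. No formal Laurent series or residues are needed. -/
theorem PowerSeries.coeff_pow_of_eq_X_mul_subst {K : Type*} [Field K] [CharZero K] {f φ : K⟦X⟧}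
    (hf : f = X * φ.subst f) (n k : ℕ) (hk : k ≤ n) :
    (n : K) * coeff n (f ^ k) = k * coeff (n - k) (φ ^ n) := by
  have hdvd : X ∣ f := ⟨_, hf⟩
  have hs : HasSubst f := HasSubst.of_constantCoeff_zero' (X_dvd_iff.mp hdvd)
  induction n using Nat.strong_induction_on generalizing k with
  | _ n ih =>
    have hfk : coeff n (f ^ k) = coeff (n - k) ((φ ^ k).subst f) := by
      conv_lhs => rw [hf]
      rw [mul_pow, coeff_X_pow_mul', if_pos hk, subst_pow hs]
    rcases Nat.eq_zero_or_pos k with rfl | hk0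
    · rcases Nat.eq_zero_or_pos n with rfl | hn0
      · simp
      · simp [coeff_one, hn0.ne']
    obtain ⟨N, rfl⟩ := Nat.exists_eq_add_of_le hk
    rw [Nat.add_sub_cancel_left] at hfk ⊢
    rcases N with _ | N
    · rw [hfk, coeff_subst_eq_sum_range hdvd]
      simp
    · obtain ⟨k, rfl⟩ := Nat.exists_eq_add_of_le' hk0
      have h := coeff_subst_of_coeff_pow hdvd N
        (fun j hj => ih (N + 1) (by omega) j hj) (φ ^ (k + 1))
      have hD : ((k + 1 + (N + 1) : ℕ) : K) * coeff N (d⁄dX K (φ ^ (k + 1)) * φ ^ (N + 1)) =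
          ((k + 1 : ℕ) : K) * coeff N (d⁄dX K (φ ^ (k + 1 + (N + 1)))) := by
        simp only [← coeff_C_mul, map_natCast]
        congr 1
        -- Both sides are `(k + 1) (k + N + 2) φ ^ (k + N + 1) φ'`.
        rw [derivative_pow, derivative_pow, show k + 1 + (N + 1) - 1 = k + (N + 1) by omega,
          Nat.add_sub_cancel]
        ring
      rw [coeff_derivative] at hD
      have hN : (N : K) + 1 ≠ 0 := by exact_mod_cast N.succ_ne_zero
      rw [hfk]
      apply mul_left_cancel₀ hN
      rw [mul_left_comm, h, hD]
      ring

open PowerSeries in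
/-- **Lagrange inversion**: if `f = X φ(f)`, then `(n + 1) [Xⁿ⁺¹] H(f) = [Xⁿ] H' φⁿ⁺¹`. -/
theorem PowerSeries.lagrange_inversion {K : Type*} [Field K] [CharZero K] {f φ : K⟦X⟧}
    (hf : f = X * φ.subst f) (H : K⟦X⟧) (n : ℕ) :
    ((n : K) + 1) * coeff (n + 1) (H.subst f) = coeff n (d⁄dX K H * φ ^ (n + 1)) :=
  coeff_subst_of_coeff_pow ⟨_, hf⟩ n (coeff_pow_of_eq_X_mul_subst hf (n + 1)) H

/-! ### Powers of the geometric series -/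

open PowerSeries in
theorem PowerSeries.coeff_mk_one_pow (K : Type*) [Field K] (d N : ℕ) :
    coeff N ((mk 1 : K⟦X⟧) ^ (d + 1)) = ((d + N).choose N : K) := by
  rw [mk_one_pow_eq_mk_choose_add, coeff_mk, Nat.choose_symm_add]

open PowerSeries in
theorem PowerSeries.derivative_mk_one (K : Type*) [Field K] :
    d⁄dX K (mk 1 : K⟦X⟧) = mk 1 ^ 2 := by
  ext n
  rw [coeff_derivative, coeff_mk_one_pow]
  simp [add_comm 1 n]

open PowerSeries in
/-- The coefficients of `(a (1 - X) + b X) ^ p / (1 - X) ^ (p + s + 1)` for `p = N + 1`, read off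
from the expansion `(a + b X / (1 - X)) ^ p / (1 - X) ^ (s + 1)`; here `mk 1 = 1 / (1 - X)`. -/
theorem coeff_linear_pow_mul_geometric_pow {K : Type*} [Field K] (a b : K) (N s : ℕ) :
    coeff N ((C a * (1 - X) + C b * X) ^ (N + 1) * (mk 1 : K⟦X⟧) ^ (N + 1 + (s + 1))) =
      ∑ k ∈ Finset.range (N + 1),
        ((N + 1).choose k : K) * ((N + s).choose (N - k) : K) * a ^ (N + 1 - k) * b ^ k := by
  have hI : (mk 1 : K⟦X⟧) * (1 - X) = 1 := mk_one_mul_one_sub_eq_one K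
  have : (C a * (1 - X) + C b * X) ^ (N + 1) * (mk 1 : K⟦X⟧) ^ (N + 1 + (s + 1)) =
      ∑ k ∈ Finset.range (N + 1 + 1),
        C (((N + 1).choose k : K) * a ^ (N + 1 - k) * b ^ k) * (X ^ k * mk 1 ^ (k + s + 1)) := by
    rw [pow_add (mk 1 : K⟦X⟧), ← mul_assoc, ← mul_pow,
      show (C a * (1 - X) + C b * X) * (mk 1 : K⟦X⟧) = C b * (X * mk 1) + C a by
        linear_combination C a * hI, add_pow, Finset.sum_mul]
    refine Finset.sum_congr rfl fun k _ => ?_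
    simp only [map_mul, map_pow, map_natCast]
    ring
  -- The last binomial term is divisible by `X ^ (N + 1)` and does not contribute.
  rw [this, map_sum, Finset.sum_range_succ, coeff_C_mul, coeff_X_pow_mul',
    if_neg (by omega), mul_zero, add_zero]
  refine Finset.sum_congr rfl fun k hk => ?_
  have hk' : k < N + 1 := by simpa using hk
  rw [coeff_C_mul, coeff_X_pow_mul', if_pos (by omega), coeff_mk_one_pow,
    show k + s + (N - k) = N + s by omega]
  ring

/-! ### Decomposition of colored forests -/

namespace ColoredPlaneTree

variable {κ : Type}

/-- The ordered forests with `n` vertices that may hang below a vertex of color `c`: every tree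
obeys the rule `A`, and `A` allows its root as a child of a vertex of color `c`. -/
def forests (A : Matrix κ κ ℕ) (c : κ) (n : ℕ) : Set (List (ColoredPlaneTree κ)) :=
  {ts | (ts.map numVertices).sum = n ∧ ∀ t ∈ ts, A c t.rootColor = 1 ∧ t.Obeys A}

theorem rootColor_node (c : κ) (ts : List (ColoredPlaneTree κ)) : (node c ts).rootColor = c :=
  rfl

theorem numVertices_node (c : κ) (ts : List (ColoredPlaneTree κ)) :
    (node c ts).numVertices = (ts.map numVertices).sum + 1 := by
  rw [numVertices, add_comm]

theorem obeys_node_iff {A : Matrix κ κ ℕ} {c : κ} {ts : List (ColoredPlaneTree κ)} :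
    (node c ts).Obeys A ↔ ∀ t ∈ ts, A c t.rootColor = 1 ∧ t.Obeys A :=
  ⟨fun h => by cases h with | node _ _ h₁ h₂ => exact fun t ht => ⟨h₁ t ht, h₂ t ht⟩,
    fun h => .node c ts (fun t ht => (h t ht).1) fun t ht => (h t ht).2⟩

theorem forests_zero (A : Matrix κ κ ℕ) (c : κ) : forests A c 0 = {[]} := by
  ext ts
  rcases ts with _ | ⟨⟨d, us⟩, ts⟩
  · simp [forests]
  · simp [forests, numVertices_node]

theorem cons_mem_forests_succ_iff {A : Matrix κ κ ℕ} {c d : κ} {n : ℕ}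
    {us ts : List (ColoredPlaneTree κ)} :
    node d us :: ts ∈ forests A c (n + 1) ↔
      A c d = 1 ∧ ∃ p ∈ Finset.HasAntidiagonal.antidiagonal n,
        us ∈ forests A d p.1 ∧ ts ∈ forests A c p.2 := by
  simp only [forests, Set.mem_ofPred_eq, List.map_cons, List.sum_cons, numVertices_node,
    List.mem_cons, forall_eq_or_imp, obeys_node_iff, rootColor_node, Prod.exists,
    Finset.HasAntidiagonal.mem_antidiagonal]
  constructor
  · rintro ⟨h, ⟨h₁, h₂⟩, h₃⟩
    exact ⟨h₁, _, _, by omega, ⟨rfl, h₂⟩, rfl, h₃⟩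
  · rintro ⟨h₁, a, b, h, ⟨rfl, h₂⟩, rfl, h₃⟩
    exact ⟨by omega, ⟨h₁, h₂⟩, h₃⟩

/-- The first-tree decomposition of a nonempty forest, with inverse direction as the underlying map:
a forest with `n + 1` vertices below color `c` amounts to the color `d` of the first root, the forest
below that root, and the remaining trees, the latter two having `n` vertices together. -/
noncomputable def forestsSuccEquiv (A : Matrix κ κ ℕ) (c : κ) (n : ℕ) :
    (Σ p : Finset.HasAntidiagonal.antidiagonal n, Σ d : {d // A c d = 1},
      forests A d.1 p.1.1 × forests A c p.1.2) ≃ forests A c (n + 1) :=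
  Equiv.ofBijective
    (fun x => ⟨node x.2.1.1 x.2.2.1.1 :: x.2.2.2.1, cons_mem_forests_succ_iff.mpr
      ⟨x.2.1.2, x.1.1, x.1.2, x.2.2.1.2, x.2.2.2.2⟩⟩) <| by
    constructor
    · rintro ⟨⟨⟨a, b⟩, _⟩, ⟨d, _⟩, ⟨us, hus⟩, ⟨ts, hts⟩⟩
        ⟨⟨⟨a', b'⟩, _⟩, ⟨d', _⟩, ⟨us', hus'⟩, ⟨ts', hts'⟩⟩ h
      simp only [Subtype.mk.injEq, List.cons.injEq, node.injEq] at h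
      obtain ⟨⟨rfl, rfl⟩, rfl⟩ := h
      obtain rfl : a = a' := hus.1.symm.trans hus'.1
      obtain rfl : b = b' := hts.1.symm.trans hts'.1
      rfl
    · rintro ⟨_ | ⟨⟨d, us⟩, ts⟩, h⟩
      · simp [forests] at h
      · obtain ⟨hd, p, hp, h₁, h₂⟩ := cons_mem_forests_succ_iff.mp h
        exact ⟨⟨⟨p, hp⟩, ⟨d, hd⟩, ⟨us, h₁⟩, ⟨ts, h₂⟩⟩, rfl⟩

instance finite_forests [Finite κ] (A : Matrix κ κ ℕ) (c : κ) (n : ℕ) :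
    Finite (forests A c n) := by
  induction n using Nat.strong_induction_on generalizing c with
  | _ n ih =>
    cases n with
    | zero => rw [forests_zero]; infer_instance
    | succ n =>
      have (p : Finset.HasAntidiagonal.antidiagonal n) (d : {d // A c d = 1}) :
          Finite (forests A d.1 p.1.1 × forests A c p.1.2) := by
        have hp := Finset.HasAntidiagonal.mem_antidiagonal.mp p.2
        have := ih p.1.1 (by omega) d.1
        have := ih p.1.2 (by omega) c
        infer_instance
      exact Finite.of_equiv _ (forestsSuccEquiv A c n)

theorem ncard_forests_succ [Fintype κ] (A : Matrix κ κ ℕ) (c : κ) (n : ℕ) :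
    (forests A c (n + 1)).ncard =
      ∑ p ∈ Finset.HasAntidiagonal.antidiagonal n, (∑ d with A c d = 1, (forests A d p.1).ncard) *
        (forests A c p.2).ncard := by
  rw [← Nat.card_coe_set_eq, ← Nat.card_congr (forestsSuccEquiv A c n), Nat.card_sigma,
    ← Finset.sum_coe_sort (Finset.HasAntidiagonal.antidiagonal n)]
  refine Finset.sum_congr rfl fun p _ => ?_
  rw [Nat.card_sigma, ← Finset.sum_subtype_eq_sum_filter, Finset.subtype_univ, Finset.sum_mul]
  simp [Nat.card_prod]

theorem treeCountRoot_succ (A : Matrix κ κ ℕ) (c : κ) (n : ℕ) :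
    treeCountRoot A c (n + 1) = (forests A c n).ncard := by
  have h : {T : ColoredPlaneTree κ | T.numVertices = n + 1 ∧ T.Obeys A ∧ T.rootColor = c} =
      node c '' forests A c n := by
    ext ⟨d, ts⟩
    simp only [Set.mem_ofPred_eq, numVertices_node, obeys_node_iff, rootColor_node, forests,
      Set.mem_image, node.injEq, Nat.add_right_cancel_iff]
    constructor
    · rintro ⟨h₁, h₂, rfl⟩
      exact ⟨ts, ⟨h₁, h₂⟩, rfl, rfl⟩
    · rintro ⟨_, ⟨h₁, h₂⟩, rfl, rfl⟩
      exact ⟨h₁, h₂, rfl⟩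
  rw [treeCountRoot, h, Set.ncard_image_of_injective _ fun _ _ h => (node.inj h).2]

theorem treeCount_succ [Fintype κ] (A : Matrix κ κ ℕ) (n : ℕ) :
    treeCount A (n + 1) = ∑ c, treeCountRoot A c (n + 1) := by
  have h : {T : ColoredPlaneTree κ | T.numVertices = n + 1 ∧ T.Obeys A} =
      (fun x : Σ c, forests A c n => node x.1 x.2.1) '' Set.univ := by
    ext ⟨d, ts⟩
    simp only [Set.mem_ofPred_eq, numVertices_node, obeys_node_iff, forests, Set.image_univ,
      Set.mem_range, node.injEq, Nat.add_right_cancel_iff]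
    constructor
    · exact fun h => ⟨⟨d, ts, h⟩, rfl, rfl⟩
    · rintro ⟨⟨c, _, h⟩, rfl, rfl⟩
      exact h
  have hinj : Function.Injective (fun x : Σ c, forests A c n => node x.1 x.2.1) := by
    rintro ⟨c, us, _⟩ ⟨d, ts, _⟩ h
    obtain ⟨rfl, rfl⟩ := node.inj h
    rfl
  rw [treeCount, h, Set.ncard_image_of_injective _ hinj, Set.ncard_univ, Nat.card_sigma]
  simp only [treeCountRoot_succ, Nat.card_coe_set_eq]

open PowerSeries in
/-- The generating function, by number of vertices, of the forests allowed below color `c`. -/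
noncomputable def forestSeries (A : Matrix κ κ ℕ) (c : κ) : ℚ⟦X⟧ :=
  mk fun n => ((forests A c n).ncard : ℚ)

open PowerSeries in
/-- The first-tree decomposition in terms of generating functions. -/
theorem forestSeries_mul [Fintype κ] (A : Matrix κ κ ℕ) (c : κ) :
    forestSeries A c * (1 - X * ∑ d with A c d = 1, forestSeries A d) = 1 := by
  rw [mul_one_sub, sub_eq_iff_eq_add, mul_left_comm, mul_comm (forestSeries A c)]
  ext n
  cases n with
  | zero => simp [forestSeries, forests_zero]
  | succ n =>
    rw [map_add, coeff_succ_X_mul, coeff_mul]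
    simp [forestSeries, ncard_forests_succ, coeff_one]

end ColoredPlaneTree

/-! ### Solving the system for the block matrix -/

open PowerSeries in
/-- The system `P = 1 / (1 - X (a P + b Q))`, `Q = 1 / (1 - a X P)` reduces to one equation for
`u = a X P`: `Q = 1 / (1 - u)` and `u = X φ(u)` with `φ = (a (1 - X) + b X) / (1 - X) ^ 2`. -/
theorem lagrange_equation_of_block_system {K : Type*} [Field K] {a b : K} {P Q : K⟦X⟧}
    (hP : P * (1 - X * (C a * P + C b * Q)) = 1) (hQ : Q * (1 - X * (C a * P)) = 1) :
    (mk 1 : K⟦X⟧).subst (X * (C a * P)) = Q ∧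
    X * (C a * P) =
      X * ((C a * (1 - X) + C b * X) * (mk 1 : K⟦X⟧) ^ 2).subst (X * (C a * P)) := by
  have hs : HasSubst (X * (C a * P)) := HasSubst.of_constantCoeff_zero' (by simp)
  have hsub : (1 - X : K⟦X⟧).subst (X * (C a * P)) = 1 - X * (C a * P) := by
    rw [subst_sub hs, subst_X hs, ← map_one C, subst_C]
    simp
  have hI : (mk 1 : K⟦X⟧).subst (X * (C a * P)) = Q := by
    have h : (mk 1 : K⟦X⟧).subst (X * (C a * P)) * (1 - X * (C a * P)) = 1 := by
      rw [← hsub, ← subst_mul hs, mk_one_mul_one_sub_eq_one, ← map_one C, subst_C]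
      simp
    linear_combination (-(mk 1 : K⟦X⟧).subst (X * (C a * P))) * hQ + Q * h
  refine ⟨hI, ?_⟩
  have hC (c : K) : (C c : K⟦X⟧).subst (X * (C a * P)) = C c := by rw [subst_C]; rfl
  rw [subst_mul hs, subst_add hs, subst_mul hs, subst_mul hs, subst_pow hs, hsub, hI, subst_X hs,
    hC, hC]
  -- With `u = a X P`, what remains is `a P = (a (1 - u) + b u) Q ^ 2`.
  congr 1
  linear_combination C a * Q * hP - (C a * P + C a * Q) * hQ

open PowerSeries in
/-- The coefficients of `P`, from Lagrange inversion for `u = a X P` itself. -/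
theorem coeff_of_block_system_left {K : Type*} [Field K] [CharZero K] {a b : K} (ha : a ≠ 0)
    {P Q : K⟦X⟧}
    (hP : P * (1 - X * (C a * P + C b * Q)) = 1) (hQ : Q * (1 - X * (C a * P)) = 1) (N : ℕ) :
    coeff N P = ∑ k ∈ Finset.range (N + 1),
      1 / ((N : K) + 1) * ((N + 1).choose k : K) * ((2 * N).choose (N - k) : K) *
        a ^ (N - k) * b ^ k := by
  obtain ⟨-, hu⟩ := lagrange_equation_of_block_system hP hQ
  have hN : (N : K) + 1 ≠ 0 := by exact_mod_cast N.succ_ne_zero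
  have hs : HasSubst (X * (C a * P)) := HasSubst.of_constantCoeff_zero' (by simp)
  have h := lagrange_inversion hu X N
  rw [subst_X hs, coeff_succ_X_mul, coeff_C_mul, derivative_X, one_mul, mul_pow, ← pow_mul,
    show 2 * (N + 1) = N + 1 + (N + 1) by ring, coeff_linear_pow_mul_geometric_pow, ← two_mul] at h
  apply mul_left_cancel₀ (mul_ne_zero hN ha)
  rw [mul_assoc, h, Finset.mul_sum]
  refine Finset.sum_congr rfl fun k hk => ?_
  have hk' : k < N + 1 := by simpa using hk
  rw [show N + 1 - k = (N - k) + 1 by omega, pow_succ]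
  field_simp

open PowerSeries in
/-- The coefficients of `Q`, from Lagrange inversion for `1 / (1 - u)`. -/
theorem coeff_of_block_system_right {K : Type*} [Field K] [CharZero K] {a b : K} {P Q : K⟦X⟧}
    (hP : P * (1 - X * (C a * P + C b * Q)) = 1) (hQ : Q * (1 - X * (C a * P)) = 1) (N : ℕ) :
    coeff (N + 1) Q = ∑ k ∈ Finset.range (N + 1),
      1 / ((N : K) + 1) * ((N + 1).choose k : K) * ((2 * N + 2).choose (N - k) : K) *
        a ^ (N + 1 - k) * b ^ k := by
  obtain ⟨hI, hu⟩ := lagrange_equation_of_block_system hP hQ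
  have hN : (N : K) + 1 ≠ 0 := by exact_mod_cast N.succ_ne_zero
  have h := lagrange_inversion hu (mk 1) N
  rw [hI, derivative_mk_one, mul_pow, ← pow_mul, mul_left_comm, ← pow_add,
    show 2 + 2 * (N + 1) = N + 1 + (N + 2 + 1) by ring, coeff_linear_pow_mul_geometric_pow,
    show N + (N + 2) = 2 * N + 2 by ring] at h
  apply mul_left_cancel₀ hN
  rw [h, Finset.mul_sum]
  refine Finset.sum_congr rfl fun k _ => ?_
  field_simp

/-! ### Binomial identities -/

/-- The termwise identity that merges the counts of trees with a root of either kind. -/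
theorem choose_identity {K : Type*} [Field K] [CharZero K] (N k : ℕ) (hk : k ≤ N) :
    1 / ((N : K) + 2) * ((N + 2).choose (k + 1) : K) * ((2 * N + 2).choose (N - k) : K) +
      1 / ((N : K) + 1) * ((N + 1).choose k : K) * ((2 * N + 2).choose (N - k) : K) =
    2 / ((N : K) + 2) * ((N + 2).choose (k + 1) : K) * ((2 * N + 1).choose (N - k) : K) := by
  have h₁ : ((N : K) + 2) * ((N + 1).choose k : K) = ((N + 2).choose (k + 1) : K) * (k + 1) := by
    exact_mod_cast Nat.add_one_mul_choose_eq (N + 1) k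
  have h₂ : ((2 * N + 1).choose (N - k) : K) * (2 * N + 2) =
      ((2 * N + 2).choose (N - k) : K) * (N + k + 2) := by
    have := Nat.choose_mul_succ_eq (2 * N + 1) (N - k)
    rw [show 2 * N + 1 + 1 - (N - k) = N + k + 2 by omega] at this
    exact_mod_cast this
  have hN₁ : (N : K) + 1 ≠ 0 := by exact_mod_cast N.succ_ne_zero
  have hN₂ : (N : K) + 2 ≠ 0 := by exact_mod_cast (N + 1).succ_ne_zero
  field_simp
  linear_combination ((2 * N + 2).choose (N - k) : K) * h₁ - ((N + 2).choose (k + 1) : K) * h₂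

theorem two_mul_choose_middle {K : Type*} [Field K] (N : ℕ) :
    ((2 * N + 2).choose (N + 1) : K) = 2 * ((2 * N + 1).choose (N + 1) : K) := by
  have h : (2 * N + 1).choose N = (2 * N + 1).choose (N + 1) :=
    Nat.choose_symm_of_eq_add (by ring)
  rw [Nat.choose_succ_succ, h]
  push_cast
  ring

/-! ### Counting trees colored by the block matrix -/

namespace ColoredPlaneTree

/-- The forest series of `c` depends only on the row of `c`, being the inverse of a series determined
by that row. -/
theorem forestSeries_eq_of_row_eq {κ : Type} [Fintype κ] {A : Matrix κ κ ℕ} {c c' : κ}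
    (h : A c = A c') : forestSeries A c = forestSeries A c' := by
  have h₁ := forestSeries_mul A c
  have h₂ := forestSeries_mul A c'
  rw [← h] at h₂
  exact left_inv_eq_right_inv h₁ ((mul_comm _ _).trans h₂)

section
variable (ℓ m : ℕ) (i i' : Fin ℓ) (j j' : Fin m)

theorem block_castAdd_castAdd :
    blockColoringMatrix ℓ m (Fin.castAdd m i) (Fin.castAdd m i') = 1 := by
  simp [blockColoringMatrix]

theorem block_castAdd_natAdd :
    blockColoringMatrix ℓ m (Fin.castAdd m i) (Fin.natAdd ℓ j) = 1 := by
  simp [blockColoringMatrix]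

theorem block_natAdd_castAdd :
    blockColoringMatrix ℓ m (Fin.natAdd ℓ j) (Fin.castAdd m i) = 1 := by
  simp [blockColoringMatrix]

theorem block_natAdd_natAdd :
    blockColoringMatrix ℓ m (Fin.natAdd ℓ j) (Fin.natAdd ℓ j') = 0 := by
  simp [blockColoringMatrix]

theorem forestSeries_castAdd :
    forestSeries (blockColoringMatrix ℓ m) (Fin.castAdd m i) =
      forestSeries (blockColoringMatrix ℓ m) (Fin.castAdd m i') := by
  refine forestSeries_eq_of_row_eq (funext fun d => ?_)
  refine Fin.addCases (fun d => ?_) (fun d => ?_) d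
  · rw [block_castAdd_castAdd, block_castAdd_castAdd]
  · rw [block_castAdd_natAdd, block_castAdd_natAdd]

theorem forestSeries_natAdd :
    forestSeries (blockColoringMatrix ℓ m) (Fin.natAdd ℓ j) =
      forestSeries (blockColoringMatrix ℓ m) (Fin.natAdd ℓ j') := by
  refine forestSeries_eq_of_row_eq (funext fun d => ?_)
  refine Fin.addCases (fun d => ?_) (fun d => ?_) d
  · rw [block_natAdd_castAdd, block_natAdd_castAdd]
  · rw [block_natAdd_natAdd, block_natAdd_natAdd]

open PowerSeries in
theorem forestSeries_castAdd_mul :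
    forestSeries (blockColoringMatrix ℓ m) (Fin.castAdd m i) *
      (1 - X * (C (ℓ : ℚ) * forestSeries (blockColoringMatrix ℓ m) (Fin.castAdd m i) +
        C (m : ℚ) * forestSeries (blockColoringMatrix ℓ m) (Fin.natAdd ℓ j))) = 1 := by
  have h := forestSeries_mul (blockColoringMatrix ℓ m) (Fin.castAdd m i)
  rw [Finset.sum_filter, Fin.sum_univ_add] at h
  simp only [block_castAdd_castAdd, block_castAdd_natAdd, if_true] at h
  simpa [forestSeries_castAdd ℓ m _ i, forestSeries_natAdd ℓ m _ j] using h

open PowerSeries in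
theorem forestSeries_natAdd_mul :
    forestSeries (blockColoringMatrix ℓ m) (Fin.natAdd ℓ j) *
      (1 - X * (C (ℓ : ℚ) * forestSeries (blockColoringMatrix ℓ m) (Fin.castAdd m i))) = 1 := by
  have h := forestSeries_mul (blockColoringMatrix ℓ m) (Fin.natAdd ℓ j)
  rw [Finset.sum_filter, Fin.sum_univ_add] at h
  simp only [block_natAdd_castAdd, block_natAdd_natAdd, if_true] at h
  simpa [forestSeries_castAdd ℓ m _ i] using h

theorem treeCountRoot_castAdd (hm : 0 < m) (N : ℕ) :
    (treeCountRoot (blockColoringMatrix ℓ m) (Fin.castAdd m i) (N + 1) : ℚ) =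
      ∑ k ∈ Finset.range (N + 1),
        1 / ((N : ℚ) + 1) * ((N + 1).choose k : ℚ) * ((2 * N).choose (N - k) : ℚ) *
          (ℓ : ℚ) ^ (N - k) * (m : ℚ) ^ k := by
  have hℓ : (ℓ : ℚ) ≠ 0 := by exact_mod_cast i.pos.ne'
  rw [← coeff_of_block_system_left hℓ (forestSeries_castAdd_mul ℓ m i ⟨0, hm⟩)
    (forestSeries_natAdd_mul ℓ m i ⟨0, hm⟩), forestSeries, PowerSeries.coeff_mk,
    treeCountRoot_succ]

theorem treeCountRoot_natAdd (hℓ : 0 < ℓ) (N : ℕ) :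
    (treeCountRoot (blockColoringMatrix ℓ m) (Fin.natAdd ℓ j) (N + 2) : ℚ) =
      ∑ k ∈ Finset.range (N + 1),
        1 / ((N : ℚ) + 1) * ((N + 1).choose k : ℚ) * ((2 * N + 2).choose (N - k) : ℚ) *
          (ℓ : ℚ) ^ (N + 1 - k) * (m : ℚ) ^ k := by
  rw [← coeff_of_block_system_right (forestSeries_castAdd_mul ℓ m ⟨0, hℓ⟩ j)
    (forestSeries_natAdd_mul ℓ m ⟨0, hℓ⟩ j), forestSeries, PowerSeries.coeff_mk,
    treeCountRoot_succ]

theorem treeCount_block (hℓ : 0 < ℓ) (hm : 0 < m) (N : ℕ) :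
    (treeCount (blockColoringMatrix ℓ m) (N + 2) : ℚ) =
      ∑ k ∈ Finset.range (N + 2),
        2 / ((N : ℚ) + 2) * ((N + 2).choose k : ℚ) * ((2 * N + 1).choose (N + 1 - k) : ℚ) *
          (ℓ : ℚ) ^ (N + 2 - k) * (m : ℚ) ^ k := by
  rw [treeCount_succ, Fin.sum_univ_add]
  push_cast
  simp only [treeCountRoot_castAdd ℓ m _ hm, treeCountRoot_natAdd ℓ m _ hℓ, Finset.sum_const,
    Finset.card_univ, Fintype.card_fin, nsmul_eq_mul]
  -- A root among the last `m` colors contributes one more factor `m`, so its `k`-th term joins the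
  -- `(k + 1)`-st term for the other roots; the term `k = 0` stands alone.
  rw [Finset.sum_range_succ', Finset.sum_range_succ' (n := N + 1), mul_add, Finset.mul_sum,
    Finset.mul_sum, add_right_comm, ← Finset.sum_add_distrib]
  push_cast
  congr 1
  · refine Finset.sum_congr rfl fun k hk => ?_
    have hk' : k < N + 1 := by simpa using hk
    rw [show N + 1 - k = N - k + 1 by omega]
    have h := choose_identity (K := ℚ) N k (by omega)
    rw [show 2 * (N + 1) = 2 * N + 2 by ring, show (N : ℚ) + 1 + 1 = N + 2 by ring]
    linear_combination (ℓ : ℚ) ^ (N - k + 1) * (m : ℚ) ^ (k + 1) * h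
  · have h := two_mul_choose_middle (K := ℚ) N
    rw [show 2 * (N + 1) = 2 * N + 2 by ring, show (N : ℚ) + 1 + 1 = N + 2 by ring]
    simp only [h]
    ring

end

end ColoredPlaneTree

open ColoredPlaneTree in
theorem mainTheorem2 (ℓ m n : ℕ) (hℓ : 0 < ℓ) (hm : 0 < m) (hn : 0 < n) :
    (2 ≤ n →
      (treeCount (blockColoringMatrix ℓ m) n : ℚ) =
        ∑ k ∈ Finset.range n,
          (2 / (n : ℚ)) * (n.choose k : ℚ) * ((2 * n - 3).choose (n - k - 1) : ℚ) *
            (ℓ : ℚ) ^ (n - k) * (m : ℚ) ^ k) ∧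
    (∀ i : Fin (ℓ + m), (i : ℕ) < ℓ →
      (treeCountRoot (blockColoringMatrix ℓ m) i n : ℚ) =
        ∑ k ∈ Finset.range n,
          (1 / (n : ℚ)) * (n.choose k : ℚ) * ((2 * n - 2).choose (n - k - 1) : ℚ) *
            (ℓ : ℚ) ^ (n - k - 1) * (m : ℚ) ^ k) ∧
    (∀ i : Fin (ℓ + m), ℓ ≤ (i : ℕ) → 2 ≤ n →
      (treeCountRoot (blockColoringMatrix ℓ m) i n : ℚ) =
        ∑ k ∈ Finset.Icc 1 (n - 1),
          (1 / ((n : ℚ) - 1)) * ((n - 1).choose (k - 1) : ℚ) *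
            ((2 * n - 2).choose (n - k - 1) : ℚ) *
            (ℓ : ℚ) ^ (n - k) * (m : ℚ) ^ (k - 1)) := by
  refine ⟨fun h2 => ?_, fun i hi => ?_, fun i hi h2 => ?_⟩
  · obtain ⟨N, rfl⟩ := Nat.exists_eq_add_of_le' h2
    rw [treeCount_block ℓ m hℓ hm]
    refine Finset.sum_congr rfl fun k _ => ?_
    rw [show 2 * (N + 2) - 3 = 2 * N + 1 by omega, show N + 2 - k - 1 = N + 1 - k by omega]
    push_cast
    rfl
  · obtain ⟨N, rfl⟩ := Nat.exists_eq_add_of_le' hn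
    rw [show i = Fin.castAdd m ⟨i, hi⟩ from rfl, treeCountRoot_castAdd ℓ m _ hm]
    refine Finset.sum_congr rfl fun k _ => ?_
    rw [show 2 * (N + 1) - 2 = 2 * N by omega, show N + 1 - k - 1 = N - k by omega]
    push_cast
    rfl
  · obtain ⟨N, rfl⟩ := Nat.exists_eq_add_of_le' h2
    obtain ⟨j, rfl⟩ : ∃ j : Fin m, i = Fin.natAdd ℓ j :=
      ⟨⟨i - ℓ, by omega⟩, Fin.ext (by simp; omega)⟩
    rw [treeCountRoot_natAdd ℓ m _ hℓ,
      show Finset.Icc 1 (N + 2 - 1) = Finset.Ico 1 (N + 2) from rfl, Finset.sum_Ico_eq_sum_range]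
    refine Finset.sum_congr rfl fun k _ => ?_
    rw [Nat.add_sub_cancel_left, show N + 2 - 1 = N + 1 by omega,
      show 2 * (N + 2) - 2 = 2 * N + 2 by omega, show N + 2 - (1 + k) - 1 = N - k by omega,
      show N + 2 - (1 + k) = N + 1 - k by omega]
    push_cast
    rw [show (N : ℚ) + 2 - 1 = N + 1 by ring]
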